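/- Let $P$ be a non-empty countable set of atoms and $G$ a non-empty finite set of agents. Let $\mathcal C$ be one of the following classes of Kripke models (non-empty domain, one accessibility relation $R_a$ for each $a\in G$, a valuation of $P$): $\mathcal K$ (all models), $\mathcal{K}45$ (all $R_a$ transitive and Euclidean), $\mathcal S5$ (all $R_a$ reflexive, transitive and Euclidean). An action model $\mathsf M$ consists of a non-empty finite set of action points, one accessibility relation on it for each agent, and a precondition formula $\mathsf{pre}(\mathsf t)$ for each action point $\mathsf t$; $\mathsf{AM}_{\mathcal C}$ is the class of action models whose accessibility relations satisfy the conditions of $\mathcal C$ (so $\mathsf{AM}_{\mathcal K}$ contains all action models). The formulas of arbitrary action model logic for $\mathcal C$ are $$\varphi ::= p \mid \neg\varphi \mid (\varphi\wedge\varphi) \mid \Box_a\varphi \mid [\mathsf M_{\mathsf T}]\varphi \mid \forall\varphi,$$ where $p\in P$, $a\in G$, $\mathsf M\in\mathsf{AM}_{\mathcal C}$ has preconditions in this same language, $\mathsf T$ is a set of action points of $\mathsf M$, and $\forall$ is the refinement quantifier. Write $\langle\mathsf M_{\mathsf T}\rangle\varphi=\neg[\mathsf M_{\mathsf T}]\neg\varphi$,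 $\langle\mathsf M_{\mathsf s}\rangle=\langle\mathsf M_{\{\mathsf s\}}\rangle$ and $\exists\varphi=\neg\forall\neg\varphi$. Truth at a pointed model $M_s$ with $M\in\mathcal C$ is as usual for atoms, $\neg$, $\wedge$, $\Box_a$. The model $M\otimes\mathsf M$ has as states the pairs $(t,\mathsf t)$ with $M_t\models\mathsf{pre}(\mathsf t)$, with $(t,\mathsf t)R_a(u,\mathsf u)$ iff $tR_au$ and $\mathsf t\mathsf R_a\mathsf u$, and with the valuation inherited from the first component; $M_s\models[\mathsf M_{\mathsf T}]\varphi$ iff, provided that $M\otimes\mathsf M\in\mathcal C$, $\varphi$ is true at every state $(s,\mathsf t)$ of $M\otimes\mathsf M$ with $\mathsf t\in\mathsf T$. Finally, $M_s\models\forall\varphi$ iff $M'_{s'}\models\varphi$ for every refinement $M'_{s'}$ of $M_s$ with $M'\in\mathcal C$, where $M'_{s'}$ is a refinement of $M_s$ iff there is a relation $Z$ between the states of $M'$ and those of $M$ with $s'Zs$ such that whenever $t'Zt$, the states $t'$ and $t$ satisfy the same atoms and, for all $a\in G$ and $u'$ with $t'R'_au'$, there is $u$ with $tR_au$ and $u'Zu$.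 Then for each $\mathcal C\in\{\mathcal K,\mathcal K45,\mathcal S5\}$, every pointed model $M_s$ with $M\in\mathcal C$ and every formula $\varphi$ of arbitrary action model logic for $\mathcal C$: $M_s\models\exists\varphi$ if and only if there are an action model $\mathsf M\in\mathsf{AM}_{\mathcal C}$, with preconditions in the language for $\mathcal C$, and an action point $\mathsf s$ of $\mathsf M$ such that $M_s\models\langle\mathsf M_{\mathsf s}\rangle\varphi$. -/

import Mathlib

universe u v w

namespace AAML

/-- The three classes under consideration. -/
inductive FrameClass : Type
  | K
  | K45
  | S5

/-- The condition that a class puts on every accessibility relation. It is used both for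
Kripke models and for action models. -/
def FrameClass.Frame (C : FrameClass) {Agent : Type v} {S : Type w}
    (R : Agent → S → S → Prop) : Prop :=
  match C with
  | .K => True
  | .K45 => ∀ a,
      (∀ x y z, R a x y → R a y z → R a x z) ∧
      (∀ x y z, R a x y → R a x z → R a y z)
  | .S5 => ∀ a,
      (∀ x, R a x x) ∧
      (∀ x y z, R a x y → R a y z → R a x z) ∧
      (∀ x y z, R a x y → R a x z → R a y z)

/-- The accessibility relations and the valuation of a Kripke model with domain `S`.
Non-emptiness of the domain is part of `KripkeModel.InClass`. -/
structure KripkeModel (Atom : Type u) (Agent : Type v) (S : Type w) where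
  rel : Agent → S → S → Prop
  val : Atom → Set S

/-- The Kripke model belongs to the class `C`. -/
def KripkeModel.InClass {Atom : Type u} {Agent : Type v} {S : Type w}
    (M : KripkeModel Atom Agent S) (C : FrameClass) : Prop :=
  Nonempty S ∧ C.Frame M.rel

/-- `(M, s)` is a refinement of `(M', s')`: there is a simulation (atoms and forth)
from `M` to `M'` that relates `s` to `s'`. -/
def Refines {Atom : Type u} {Agent : Type v} {S S' : Type w}
    (M : KripkeModel Atom Agent S) (s : S) (M' : KripkeModel Atom Agent S') (s' : S') : Prop :=
  ∃ Z : S → S' → Prop,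
    (∀ x x', Z x x' → ∀ p, x ∈ M.val p ↔ x' ∈ M'.val p) ∧
    (∀ x x', Z x x' → ∀ a y, M.rel a x y → ∃ y', M'.rel a x' y' ∧ Z y y') ∧
    Z s s'

/-- An action model with preconditions in `L`: a finite non-empty domain of action points,
accessibility relations, and preconditions. -/
structure ActionModel (Agent : Type v) (L : Type u) where
  Point : Type
  finite : Finite Point
  nonempty : Nonempty Point
  rel : Agent → Point → Point → Prop
  pre : Point → L

/-- The action model belongs to the class of action models corresponding to `C`. -/
def ActionModel.InClass {Agent : Type v} {L : Type u}
    (A : ActionModel Agent L) (C : FrameClass) : Prop :=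
  C.Frame A.rel

/-- Formulas of arbitrary action model logic. The constructor `act` takes the components of a
multi-pointed action model whose preconditions are formulas; see `Form.boxAct`. -/
inductive Form (Atom : Type u) (Agent : Type v) : Type (max u v 1)
  | atom (p : Atom) : Form Atom Agent
  | neg (φ : Form Atom Agent) : Form Atom Agent
  | and (φ ψ : Form Atom Agent) : Form Atom Agent
  | box (a : Agent) (φ : Form Atom Agent) : Form Atom Agent
  | act (P : Type) (finite : Finite P) (nonempty : Nonempty P)
      (rel : Agent → P → P → Prop) (pre : P → Form Atom Agent) (T : Set P)
      (φ : Form Atom Agent) : Form Atom Agent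
  | allRef (φ : Form Atom Agent) : Form Atom Agent

/-- `[A_T] φ`. -/
def Form.boxAct {Atom : Type u} {Agent : Type v}
    (A : ActionModel Agent (Form Atom Agent)) (T : Set A.Point) (φ : Form Atom Agent) :
    Form Atom Agent :=
  .act A.Point A.finite A.nonempty A.rel A.pre T φ

/-- `⟨A_T⟩ φ`, an abbreviation of `¬ [A_T] ¬ φ`. -/
def Form.diaAct {Atom : Type u} {Agent : Type v}
    (A : ActionModel Agent (Form Atom Agent)) (T : Set A.Point) (φ : Form Atom Agent) :
    Form Atom Agent :=
  .neg (.boxAct A T (.neg φ))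

/-- The existential refinement quantifier, an abbreviation of `¬ ∀ref ¬ φ`. -/
def Form.someRef {Atom : Type u} {Agent : Type v} (φ : Form Atom Agent) : Form Atom Agent :=
  .neg (.allRef (.neg φ))

/-- The formula belongs to the language for the class `C`: every action model that occurs in it
(also inside preconditions) is in the class of action models corresponding to `C`. -/
def Form.InLang {Atom : Type u} {Agent : Type v} (C : FrameClass) : Form Atom Agent → Prop
  | .atom _ => True
  | .neg φ => φ.InLang C
  | .and φ ψ => φ.InLang C ∧ ψ.InLang C
  | .box _ φ => φ.InLang C
  | .act _ _ _ rel pre _ φ => C.Frame rel ∧ (∀ t, (pre t).InLang C) ∧ φ.InLang C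
  | .allRef φ => φ.InLang C

/-- The restricted product of a Kripke model with a family of relations on `P`, where `h s t`
says that the state `s` satisfies the precondition of `t`. -/
def KripkeModel.update {Atom : Type u} {Agent : Type v} {S : Type w} {P : Type}
    (M : KripkeModel Atom Agent S) (rel : Agent → P → P → Prop) (h : S → P → Prop) :
    KripkeModel Atom Agent {x : S × P // h x.1 x.2} where
  rel a x y := M.rel a x.1.1 y.1.1 ∧ rel a x.1.2 y.1.2
  val p := {x | x.1.1 ∈ M.val p}

/-- Truth of a formula at a state of a Kripke model, in the logic of the class `C`. -/
def Sat {Atom : Type u} {Agent : Type v} (C : FrameClass) :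
    Form Atom Agent → ∀ {S : Type w}, KripkeModel Atom Agent S → S → Prop
  | .atom p, _, M, s => s ∈ M.val p
  | .neg φ, _, M, s => ¬ Sat C φ M s
  | .and φ ψ, _, M, s => Sat C φ M s ∧ Sat C ψ M s
  | .box a φ, _, M, s => ∀ t, M.rel a s t → Sat C φ M t
  | .act _ _ _ rel pre T φ, _, M, s =>
      (M.update rel (fun x t => Sat C (pre t) M x)).InClass C →
        ∀ t ∈ T, ∀ h : Sat C (pre t) M s,
          Sat C φ (M.update rel (fun x t => Sat C (pre t) M x)) ⟨(s, t), h⟩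
  | .allRef φ, _, M, s =>
      ∀ (S' : Type w) (M' : KripkeModel Atom Agent S') (s' : S'),
        M'.InClass C → Refines M' s' M s → Sat C φ M' s'

/-- Over the class `K` the language is the full language. -/
theorem Form.inLang_K {Atom : Type u} {Agent : Type v} (φ : Form Atom Agent) :
    φ.InLang .K := by
  induction φ with
  | atom p => trivial
  | neg φ ih => exact ih
  | and φ ψ ih₁ ih₂ => exact ⟨ih₁, ih₂⟩
  | box a φ ih => exact ih
  | act P f n rel pre T φ ih₁ ih₂ => exact ⟨trivial, ih₁, ih₂⟩
  | allRef φ ih => exact ih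

end AAML

/-!
A formula sees only finitely many atoms and agents, and only a bounded depth of a pointed model.
So, given a refinement `M'_{s'}` of `M_s`, it suffices to find an action model whose product with
`M_s` has the same bisimulation type of depth `n` as `M'_{s'}`. Its points are states of `M'`,
taken up to bisimulation type, together with the depth up to which the product is to imitate that
state. The precondition of a point says that the present state looks like one that simulates the
imitated state; up to a bounded depth this is a modal formula.

A step along `a` lowers the depth by one, except that over `K45` and `S5` a further `a`-step
stays in the same `a`-cluster, where transitivity forbids lowering it. Hence points also carry
the agent along which they were reached, and for this agent the set of types of successors is
imitated in full depth.

That every formula is invariant under some bisimulation type is proved by induction on formulas.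
In the case of the refinement quantifier the same action model transfers a refinement from one
model to another of the same type, as its product with the latter is again a refinement.
-/

namespace AAML

variable {Atom : Type u} {Agent : Type v} {C : FrameClass}

/-! ### Bisimulation types of bounded depth -/

/-- A finite set of atoms and a finite set of agents, the part of the language that a formula can
observe. -/
abbrev Vocabulary (Atom : Type u) (Agent : Type v) : Type (max u v) :=
  Finset Atom × Finset Agent

/-- The possible bisimulation types of depth `k`: a type of depth `k + 1` records the true atoms
and, for each agent, the set of types of depth `k` of the successors. At depth `0` not even the
atoms are recorded. -/
def BisimType (V : Vocabulary Atom Agent) : ℕ → Type (max u v)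
  | 0 => PUnit
  | k + 1 => Set V.1 × (V.2 → Set (BisimType V k))

instance BisimType.finite (V : Vocabulary Atom Agent) : ∀ k, Finite (BisimType V k)
  | 0 => inferInstanceAs (Finite PUnit)
  | k + 1 =>
    have := BisimType.finite V k
    inferInstanceAs (Finite (Set V.1 × (V.2 → Set (BisimType V k))))

/-- The bisimulation type of depth `k` of a state: two states have the same one iff they are
bisimilar up to depth `k` with respect to the atoms and agents in `V`. -/
def bisimType (V : Vocabulary Atom Agent) :
    (k : ℕ) → {S : Type w} → KripkeModel Atom Agent S → S → BisimType V k
  | 0, _, _, _ => PUnit.unit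
  | k + 1, _, M, s => ({p | s ∈ M.val p}, fun a => bisimType V k M '' {t | M.rel a s t})

/-- The bisimulation types of depth `k` of the `a`-successors of a state. -/
def succTypes (V : Vocabulary Atom Agent) (k : ℕ) (a : Agent) {S : Type w}
    (M : KripkeModel Atom Agent S) (s : S) : Set (BisimType V k) :=
  bisimType V k M '' {t | M.rel a s t}

section BisimType

variable {V : Vocabulary Atom Agent} {k : ℕ} {S S' : Type w}
  {M : KripkeModel Atom Agent S} {M' : KripkeModel Atom Agent S'} {s : S} {s' : S'}

theorem BisimType.ext_iff {σ τ : BisimType V (k + 1)} :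
    σ = τ ↔ (∀ p, p ∈ σ.1 ↔ p ∈ τ.1) ∧ ∀ a, σ.2 a = τ.2 a :=
  Prod.ext_iff.trans (and_congr Set.ext_iff funext_iff)

theorem bisimType_succ_eq_iff :
    bisimType V (k + 1) M s = bisimType V (k + 1) M' s' ↔
      (∀ p ∈ V.1, s ∈ M.val p ↔ s' ∈ M'.val p) ∧
        ∀ a ∈ V.2, succTypes V k a M s = succTypes V k a M' s' :=
  BisimType.ext_iff.trans (and_congr Subtype.forall Subtype.forall)

theorem bisimType_eq_of_le {V' : Vocabulary Atom Agent} {k' : ℕ} (hV : V ≤ V') (hk : k ≤ k')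
    (h : bisimType V' k' M s = bisimType V' k' M' s') :
    bisimType V k M s = bisimType V k M' s' := by
  induction k generalizing k' s s' with
  | zero => rfl
  | succ k ih =>
    obtain ⟨k', rfl⟩ := Nat.exists_eq_add_of_lt hk
    obtain ⟨hval, hsucc⟩ := bisimType_succ_eq_iff.mp h
    refine bisimType_succ_eq_iff.mpr ⟨fun p hp => hval p (hV.1 hp), fun a ha => ?_⟩
    refine Set.Subset.antisymm ?_ ?_ <;> rintro _ ⟨t, ht, rfl⟩
    · obtain ⟨t', ht', e⟩ := (hsucc a (hV.2 ha)).subset ⟨t, ht, rfl⟩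
      exact ⟨t', ht', (ih (by omega) e.symm).symm⟩
    · obtain ⟨t', ht', e⟩ := (hsucc a (hV.2 ha)).superset ⟨t, ht, rfl⟩
      exact ⟨t', ht', ih (by omega) e⟩

end BisimType

/-- A property of pointed Kripke models. -/
abbrev PointedProperty (Atom : Type u) (Agent : Type v) : Type (max u v (w + 1)) :=
  ∀ S : Type w, KripkeModel Atom Agent S → S → Prop

/-- On models in `C`, the property depends only on the bisimulation type of depth `k`. -/
def PointedProperty.Invariant (C : FrameClass) (V : Vocabulary Atom Agent) (k : ℕ)
    (P : PointedProperty.{u, v, w} Atom Agent) : Prop :=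
  ∀ ⦃S S' : Type w⦄ ⦃M : KripkeModel Atom Agent S⦄ ⦃M' : KripkeModel Atom Agent S'⦄ ⦃s : S⦄
    ⦃s' : S'⦄, M.InClass C → M'.InClass C → bisimType V k M s = bisimType V k M' s' →
      P S M s → P S' M' s'

theorem PointedProperty.Invariant.mono {V V' : Vocabulary Atom Agent} {k k' : ℕ}
    {P : PointedProperty.{u, v, w} Atom Agent} (h : P.Invariant C V k) (hV : V ≤ V')
    (hk : k ≤ k') : P.Invariant C V' k' :=
  fun _ _ _ _ _ _ hM hM' e => h hM hM' (bisimType_eq_of_le hV hk e)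

/-! ### Definability of invariant properties -/

/-- On models in `C`, the property is expressed by a formula of the language for `C`. -/
def Definable (C : FrameClass) (P : PointedProperty.{u, v, w} Atom Agent) : Prop :=
  ∃ ψ : Form Atom Agent, ψ.InLang C ∧
    ∀ (S : Type w) (M : KripkeModel Atom Agent S) (s : S), M.InClass C →
      (Sat C ψ M s ↔ P S M s)

namespace Definable

variable {P P' : PointedProperty.{u, v, w} Atom Agent}

theorem congr (h : Definable C P) (e : ∀ S M s, M.InClass C → (P S M s ↔ P' S M s)) :
    Definable C P' := by
  obtain ⟨ψ, hψ, hsat⟩ := h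
  exact ⟨ψ, hψ, fun S M s hM => (hsat S M s hM).trans (e S M s hM)⟩

theorem atom (p : Atom) : Definable (Agent := Agent) C fun (_ : Type w) M s => s ∈ M.val p :=
  ⟨.atom p, trivial, fun _ _ _ _ => Iff.rfl⟩

theorem not (h : Definable C P) : Definable C fun S M s => ¬ P S M s := by
  obtain ⟨ψ, hψ, hsat⟩ := h
  exact ⟨.neg ψ, hψ, fun S M s hM => not_congr (hsat S M s hM)⟩

theorem and (h : Definable C P) (h' : Definable C P') :
    Definable C fun S M s => P S M s ∧ P' S M s := by
  obtain ⟨ψ, hψ, hsat⟩ := h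
  obtain ⟨ψ', hψ', hsat'⟩ := h'
  exact ⟨.and ψ ψ', ⟨hψ, hψ'⟩, fun S M s hM => and_congr (hsat S M s hM) (hsat' S M s hM)⟩

theorem dia (a : Agent) (h : Definable C P) :
    Definable C fun S M s => ∃ t, M.rel a s t ∧ P S M t := by
  obtain ⟨ψ, hψ, hsat⟩ := h.not
  refine Definable.not ⟨.box a ψ, hψ, fun S M s hM => forall₂_congr fun t _ => hsat S M t hM⟩
    |>.congr fun S M s _ => ?_
  simp only [not_forall, not_not, exists_prop]

theorem imp (h : Definable C P) (h' : Definable C P') :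
    Definable C fun S M s => P S M s → P' S M s :=
  (h.and h'.not).not.congr fun _ _ _ _ => not_and_not_right

theorem iff (h : Definable C P) (h' : Definable C P') :
    Definable C fun S M s => P S M s ↔ P' S M s :=
  ((h.imp h').and (h'.imp h)).congr fun _ _ _ _ => iff_def.symm

theorem const [Nonempty Atom] (c : Prop) :
    Definable (Atom := Atom) (Agent := Agent) C fun (_ : Type w) _ _ => c := by
  obtain ⟨p⟩ := ‹Nonempty Atom›
  have hfalse := (atom (Agent := Agent) (C := C) p).and (atom p).not
  by_cases hc : c
  · exact hfalse.not.congr fun _ _ _ _ => by simp only [and_not_self_iff, not_false_eq_true, hc]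
  · exact hfalse.congr fun _ _ _ _ => by simp only [and_not_self_iff, hc]

theorem forall_mem_finset [Nonempty Atom] {ι : Type*}
    {R : ι → PointedProperty.{u, v, w} Atom Agent} (h : ∀ i, Definable C (R i)) (F : Finset ι) :
    Definable C fun S M s => ∀ i ∈ F, R i S M s := by
  classical
  induction F using Finset.induction_on with
  | empty =>
    exact (const True).congr fun _ _ _ _ => by
      simp only [Finset.notMem_empty, IsEmpty.forall_iff, implies_true]
  | insert i F _ ih =>
    exact ((h i).and ih).congr fun _ _ _ _ => by simp only [Finset.forall_mem_insert]

theorem forall_finite [Nonempty Atom] {ι : Type*} [Finite ι]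
    {R : ι → PointedProperty.{u, v, w} Atom Agent} (h : ∀ i, Definable C (R i)) :
    Definable C fun S M s => ∀ i, R i S M s := by
  have := Fintype.ofFinite ι
  exact (forall_mem_finset h Finset.univ).congr fun _ _ _ _ => by
    simp only [Finset.mem_univ, forall_const]

theorem bisimType_eq [Nonempty Atom] (V : Vocabulary Atom Agent) :
    ∀ (k : ℕ) (τ : BisimType V k), Definable C fun (_ : Type w) M s => bisimType V k M s = τ
  | 0, _ => (const True).congr fun _ _ _ _ => iff_of_true trivial rfl
  | k + 1, τ => by
    have hval : Definable C fun (S : Type w) (M : KripkeModel Atom Agent S) s =>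
        ∀ p : V.1, s ∈ M.val p ↔ p ∈ τ.1 :=
      forall_finite fun p => (atom p.1).iff (const _)
    have hsucc : Definable C fun (S : Type w) (M : KripkeModel Atom Agent S) s =>
        ∀ (a : V.2) (σ : BisimType V k), σ ∈ succTypes V k a.1 M s ↔ σ ∈ τ.2 a :=
      forall_finite fun a => forall_finite fun σ => ((bisimType_eq V k σ).dia a.1).iff (const _)
    exact (hval.and hsucc).congr fun S M s _ => (and_congr_right fun _ =>
      forall_congr' fun _ => Set.ext_iff.symm).trans
        (BisimType.ext_iff (σ := bisimType V (k + 1) M s) (τ := τ)).symm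

theorem of_invariant [Nonempty Atom] {V : Vocabulary Atom Agent} {k : ℕ}
    (h : P.Invariant C V k) : Definable C P := by
  have hdisj : Definable C fun (S : Type w) (M : KripkeModel Atom Agent S) s =>
      ∀ τ : BisimType V k, bisimType V k M s = τ →
        ∃ (S' : Type w) (M' : KripkeModel Atom Agent S') (s' : S'),
          M'.InClass C ∧ bisimType V k M' s' = τ ∧ P S' M' s' :=
    forall_finite fun τ => (bisimType_eq V k τ).imp (const _)
  refine hdisj.congr fun S M s hM => ⟨fun hs => ?_, fun hs τ hτ => ⟨S, M, s, hM, hτ, hs⟩⟩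
  obtain ⟨S', M', s', hM', e, hs'⟩ := hs _ rfl
  exact h hM' hM e hs'

end Definable

/-! ### Products with action models -/

theorem FrameClass.frame_iff {S : Type w} {R : Agent → S → S → Prop} :
    C.Frame R ↔ (C = .S5 → ∀ a x, R a x x) ∧
      (C ≠ .K → ∀ a x y z, R a x y → (R a x z ↔ R a y z)) := by
  cases C with
  | K => simp [FrameClass.Frame]
  | K45 =>
    simp only [Frame, reduceCtorEq, IsEmpty.forall_iff, ne_eq, not_false_eq_true, forall_const,
      true_and]
    exact ⟨fun h a x y z hxy => ⟨(h a).2 x y z hxy, (h a).1 x y z hxy⟩,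
      fun h a => ⟨fun x y z hxy => (h a x y z hxy).mpr, fun x y z hxy => (h a x y z hxy).mp⟩⟩
  | S5 =>
    simp only [Frame, ne_eq, reduceCtorEq, not_false_eq_true, forall_const]
    exact ⟨fun h => ⟨fun a => (h a).1,
        fun a x y z hxy => ⟨(h a).2.2 x y z hxy, (h a).2.1 x y z hxy⟩⟩,
      fun h a => ⟨h.1 a, fun x y z hxy => (h.2 a x y z hxy).mpr,
        fun x y z hxy => (h.2 a x y z hxy).mp⟩⟩

section Update

variable {S : Type w} {P : Type} {M : KripkeModel Atom Agent S} {rel : Agent → P → P → Prop}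
  {h : S → P → Prop} {s : S} {t : P}

theorem KripkeModel.InClass.update (hM : M.InClass C) (hrel : C.Frame rel) (hst : h s t) :
    (M.update rel h).InClass C := by
  have hM := FrameClass.frame_iff.mp hM.2
  have hrel := FrameClass.frame_iff.mp hrel
  exact ⟨⟨⟨(s, t), hst⟩⟩, FrameClass.frame_iff.mpr
    ⟨fun hC a x => ⟨hM.1 hC a _, hrel.1 hC a _⟩, fun hC a x y z hxy =>
      and_congr (hM.2 hC a _ _ _ hxy.1) (hrel.2 hC a _ _ _ hxy.2)⟩⟩

theorem refines_update (hst : h s t) : Refines (M.update rel h) ⟨(s, t), hst⟩ M s :=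
  ⟨fun x y => x.1.1 = y, fun _ _ e _ => e ▸ Iff.rfl,
    fun _ _ e _ y hy => ⟨y.1.1, e ▸ hy.1, rfl⟩, rfl⟩

theorem bisimType_update_congr {S' : Type w} {M' : KripkeModel Atom Agent S'} {h' : S' → P → Prop}
    {V : Vocabulary Atom Agent} {m : ℕ}
    (hh : ∀ s s', bisimType V m M s = bisimType V m M' s' → ∀ t, h s t ↔ h' s' t) (k : ℕ)
    {s' : S'} (hst : h s t) (hst' : h' s' t)
    (e : bisimType V (m + k) M s = bisimType V (m + k) M' s') :
    bisimType V k (M.update rel h) ⟨(s, t), hst⟩ =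
      bisimType V k (M'.update rel h') ⟨(s', t), hst'⟩ := by
  induction k generalizing s s' t with
  | zero => rfl
  | succ k ih =>
    obtain ⟨hval, hsucc⟩ := bisimType_succ_eq_iff.mp e
    have hpre {u u'} (e : bisimType V (m + k) M u = bisimType V (m + k) M' u') (y : P) :
        h u y ↔ h' u' y := hh u u' (bisimType_eq_of_le le_rfl (Nat.le_add_right m k) e) y
    refine bisimType_succ_eq_iff.mpr ⟨hval, fun a ha => Set.Subset.antisymm ?_ ?_⟩
    · rintro _ ⟨⟨⟨u, y⟩, huy⟩, hr, rfl⟩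
      obtain ⟨u', hu', eu⟩ := (hsucc a ha).subset ⟨u, hr.1, rfl⟩
      have huy' := (hpre eu.symm y).mp huy
      exact ⟨⟨(u', y), huy'⟩, ⟨hu', hr.2⟩, (ih huy huy' eu.symm).symm⟩
    · rintro _ ⟨⟨⟨u', y⟩, huy'⟩, hr, rfl⟩
      obtain ⟨u, hu, eu⟩ := (hsucc a ha).superset ⟨u', hr.1, rfl⟩
      have huy := (hpre eu y).mpr huy'
      exact ⟨⟨(u, y), huy⟩, ⟨hu, hr.2⟩, ih huy huy' eu⟩

end Update

/-- The product `M ⊗ A` of the paper, in the logic of the class `C`. -/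
abbrev KripkeModel.prod {S : Type w} (C : FrameClass) (M : KripkeModel Atom Agent S)
    (A : ActionModel Agent (Form Atom Agent)) :
    KripkeModel Atom Agent {x : S × A.Point // Sat C (A.pre x.2) M x.1} :=
  M.update A.rel fun t y => Sat C (A.pre y) M t

theorem sat_diaAct_singleton {S : Type w} {M : KripkeModel Atom Agent S} {s : S}
    {A : ActionModel Agent (Form Atom Agent)} {a : A.Point} {φ : Form Atom Agent} :
    Sat C (.diaAct A {a} φ) M s ↔
      (M.prod C A).InClass C ∧ ∃ h : Sat C (A.pre a) M s, Sat C φ (M.prod C A) ⟨(s, a), h⟩ := by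
  simp only [Form.diaAct, Form.boxAct, Sat, Set.mem_singleton_iff, forall_eq, not_forall, not_not,
    exists_prop]

theorem sat_someRef {S : Type w} {M : KripkeModel Atom Agent S} {s : S} {φ : Form Atom Agent} :
    Sat C φ.someRef M s ↔ ∃ (S' : Type w) (M' : KripkeModel Atom Agent S') (s' : S'),
      M'.InClass C ∧ Refines M' s' M s ∧ Sat C φ M' s' := by
  simp only [Form.someRef, Sat, not_forall, not_not, exists_prop]

/-! ### Agreement up to a depth and a tag -/

/-- The agent, if any, for which a point reached along `a` keeps track of the types of its
successors in full depth. -/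
def FrameClass.tag : FrameClass → Agent → Option Agent
  | .K, _ => none
  | .K45, a | .S5, a => some a

theorem FrameClass.mem_tag_iff {a b : Agent} : b ∈ C.tag a ↔ C ≠ .K ∧ a = b := by
  cases C <;> simp [tag]

theorem FrameClass.Frame.succTypes_eq {S : Type w} {M : KripkeModel Atom Agent S}
    (hM : C.Frame M.rel) (hC : C ≠ .K) {a : Agent} {s t : S} (hst : M.rel a s t)
    (V : Vocabulary Atom Agent) (k : ℕ) : succTypes V k a M s = succTypes V k a M t := by
  simp only [succTypes, (FrameClass.frame_iff.mp hM).2 hC a s t _ hst]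

open Classical in
/-- The depth to which the `a`-successors of a state are known, when the state itself is known to
depth `k` and the `b`-successors of the state, if `b` is not `none`, are known to depth `k` too. -/
noncomputable def succDepth (k : ℕ) (b : Option Agent) (a : Agent) : ℕ :=
  if a ∈ b then k else k - 1

theorem succDepth_of_mem {k : ℕ} {b : Option Agent} {a : Agent} (h : a ∈ b) :
    succDepth k b a = k :=
  if_pos h

theorem succDepth_of_notMem {k : ℕ} {b : Option Agent} {a : Agent} (h : a ∉ b) :
    succDepth k b a = k - 1 :=
  if_neg h

theorem succDepth_le (k : ℕ) (b : Option Agent) (a : Agent) : succDepth k b a ≤ k := by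
  unfold succDepth; split <;> omega

theorem le_succDepth_of_lt {k l : ℕ} (h : l < k) (b : Option Agent) (a : Agent) :
    l ≤ succDepth k b a := by
  unfold succDepth; split <;> omega

/-- Equality of types of depth `k`, and of the sets of types of depth `k` of the successors along
the agent `b`. In the hierarchy of bisimulation types this lies between the depths `k` and
`k + 1`. -/
def Agree (V : Vocabulary Atom Agent) (k : ℕ) (b : Option Agent) {S S' : Type w}
    (M : KripkeModel Atom Agent S) (s : S) (M' : KripkeModel Atom Agent S') (s' : S') : Prop :=
  bisimType V k M s = bisimType V k M' s' ∧
    ∀ a ∈ V.2, a ∈ b → succTypes V k a M s = succTypes V k a M' s'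

namespace Agree

variable {V : Vocabulary Atom Agent} {k : ℕ} {b : Option Agent} {S S' S'' : Type w}
  {M : KripkeModel Atom Agent S} {M' : KripkeModel Atom Agent S'}
  {M'' : KripkeModel Atom Agent S''} {s : S} {s' : S'} {s'' : S''}

theorem symm (h : Agree V k b M s M' s') : Agree V k b M' s' M s :=
  ⟨h.1.symm, fun a ha hab => (h.2 a ha hab).symm⟩

theorem trans (h : Agree V k b M s M' s') (h' : Agree V k b M' s' M'' s'') :
    Agree V k b M s M'' s'' :=
  ⟨h.1.trans h'.1, fun a ha hab => (h.2 a ha hab).trans (h'.2 a ha hab)⟩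

theorem none_iff : Agree V k none M s M' s' ↔ bisimType V k M s = bisimType V k M' s' := by
  simp only [Agree, Option.mem_def, reduceCtorEq, IsEmpty.forall_iff, implies_true, and_true]

theorem of_bisimType_eq {m : ℕ} (hk : k < m) (h : bisimType V m M s = bisimType V m M' s') :
    Agree V k b M s M' s' := by
  have hsucc := (bisimType_succ_eq_iff.mp (bisimType_eq_of_le le_rfl hk h)).2
  exact ⟨bisimType_eq_of_le le_rfl hk.le h, fun a ha _ => hsucc a ha⟩

theorem mem_val_iff (hk : 0 < k) (h : Agree V k b M s M' s') {p : Atom} (hp : p ∈ V.1) :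
    s ∈ M.val p ↔ s' ∈ M'.val p :=
  (bisimType_succ_eq_iff.mp (bisimType_eq_of_le le_rfl hk h.1)).1 p hp

theorem succTypes_eq (hk : 0 < k) (h : Agree V k b M s M' s') {a : Agent} (ha : a ∈ V.2) :
    succTypes V (succDepth k b a) a M s = succTypes V (succDepth k b a) a M' s' := by
  by_cases hab : a ∈ b
  · rw [succDepth_of_mem hab]
    exact h.2 a ha hab
  · rw [succDepth_of_notMem hab]
    exact (bisimType_succ_eq_iff.mp (bisimType_eq_of_le le_rfl (by omega) h.1)).2 a ha

theorem exists_rel (hM : C.Frame M.rel) (hM' : C.Frame M'.rel) (hk : 0 < k)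
    (h : Agree V k b M s M' s') {a : Agent} (ha : a ∈ V.2) {t : S} (hst : M.rel a s t) :
    ∃ t', M'.rel a s' t' ∧ Agree V (succDepth k b a) (C.tag a) M t M' t' := by
  have hsucc := h.succTypes_eq hk ha
  obtain ⟨t', hst', e⟩ := hsucc.subset ⟨t, hst, rfl⟩
  refine ⟨t', hst', e.symm, fun c _ hc => ?_⟩
  obtain ⟨hC, rfl⟩ := FrameClass.mem_tag_iff.mp hc
  rw [← hM.succTypes_eq hC hst, ← hM'.succTypes_eq hC hst', hsucc]

end Agree

/-! ### The points of the action model -/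

/-- A point of the action model for a refinement with states `S'`: the product is to agree with
`state` up to depth `level` and tag `tag`. -/
structure Point (Agent : Type v) (S' : Type w) where
  level : ℕ
  tag : Option Agent
  state : S'

namespace Point

variable {V : Vocabulary Atom Agent} {S' : Type w} {M' : KripkeModel Atom Agent S'} {t : S'}
  {x y : Point Agent S'} {a : Agent}

/-- The depth to which the `a`-successors of a point are prescribed. -/
noncomputable def depth (x : Point Agent S') (a : Agent) : ℕ :=
  succDepth x.level x.tag a

/-- The two points prescribe the same types of `a`-successors, to the same depth. -/
def SameCluster (V : Vocabulary Atom Agent) (M' : KripkeModel Atom Agent S') (a : Agent)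
    (x y : Point Agent S') : Prop :=
  x.depth a = y.depth a ∧
    succTypes V (x.depth a) a M' x.state = succTypes V (x.depth a) a M' y.state

/-- The accessibility relations between points: as many edges as the types of the successors
permit, subject over `K45` and `S5` to being transitive and Euclidean. -/
def rel (C : FrameClass) (V : Vocabulary Atom Agent) (M' : KripkeModel Atom Agent S') (a : Agent)
    (x y : Point Agent S') : Prop :=
  x.depth a ≤ y.level ∧
    bisimType V (x.depth a) M' y.state ∈ succTypes V (x.depth a) a M' x.state ∧
    (C ≠ .K → SameCluster V M' a x y)

theorem SameCluster.rel_iff (h : SameCluster V M' a x y) (z : Point Agent S') :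
    rel C V M' a x z ↔ rel C V M' a y z := by
  obtain ⟨hdepth, hsucc⟩ := h
  unfold rel SameCluster
  rw [hsucc, hdepth]

theorem frame_rel (hM' : C.Frame M'.rel) {P : Type} (π : P → Point Agent S') :
    C.Frame fun a x y => rel C V M' a (π x) (π y) := by
  refine FrameClass.frame_iff.mpr ⟨fun hC a x => ?_, fun hC a x y z hxy => ?_⟩
  · have hrefl := (FrameClass.frame_iff.mp hM').1 hC a (π x).state
    exact ⟨succDepth_le _ _ _, ⟨_, hrefl, rfl⟩, fun _ => ⟨rfl, rfl⟩⟩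
  · exact (hxy.2.2 hC).rel_iff (π z)

/-- The point `y` is suited for imitating an `a`-step from the state of `x` to `t`. -/
structure Tracks (C : FrameClass) (V : Vocabulary Atom Agent) (M' : KripkeModel Atom Agent S')
    (a : Agent) (x : Point Agent S') (t : S') (y : Point Agent S') : Prop where
  level_eq : y.level = x.depth a
  tag_eq : y.tag = C.tag a
  agree : Agree V y.level y.tag M' t M' y.state

theorem Tracks.rel (hM' : C.Frame M'.rel) (ha : a ∈ V.2) (ht : M'.rel a x.state t)
    (h : Tracks C V M' a x t y) : rel C V M' a x y := by
  obtain ⟨hlevel, htag, hagree⟩ := h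
  rw [hlevel] at hagree
  refine ⟨hlevel.ge, ⟨t, ht, hagree.1⟩, fun hC => ?_⟩
  have hmem : a ∈ y.tag := htag ▸ FrameClass.mem_tag_iff.mpr ⟨hC, rfl⟩
  exact ⟨hlevel.symm.trans (succDepth_of_mem hmem).symm,
    (hM'.succTypes_eq hC ht V _).trans (hagree.2 a ha hmem)⟩

/-- Every step from the state of a point of the family along an agent in `V` can be imitated within
the family: a closed family supplies the action points of an action model. -/
def Closed (C : FrameClass) (V : Vocabulary Atom Agent) (M' : KripkeModel Atom Agent S')
    {P : Type} (π : P → Point Agent S') : Prop :=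
  ∀ x, ∀ a ∈ V.2, ∀ t, M'.rel a (π x).state t → ∃ y, Tracks C V M' a (π x) t (π y)

theorem exists_closed_family (C : FrameClass) (V : Vocabulary Atom Agent) (n : ℕ)
    (M' : KripkeModel Atom Agent S') (s' : S') :
    ∃ (m : ℕ) (π : Fin m → Point Agent S') (x : Fin m), Closed C V M' π ∧ (π x).level = n ∧
      (π x).tag = none ∧ bisimType V n M' s' = bisimType V n M' (π x).state := by
  obtain ⟨m, ⟨e⟩⟩ := Finite.exists_equiv_fin
    (Fin (n + 1) × Finset.insertNone V.2 × Set.range (bisimType V (n + 1) M'))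
  let π (x : Fin m) : Point Agent S' :=
    ⟨(e.symm x).1, (e.symm x).2.1, (e.symm x).2.2.2.choose⟩
  have hlevel (x) : (π x).level ≤ n := Nat.le_of_lt_succ (e.symm x).1.2
  have hπ {l} (hl : l ≤ n) {b} (hb : b ∈ Finset.insertNone V.2) (t : S') :
      ∃ x, (π x).level = l ∧ (π x).tag = b ∧
        bisimType V (n + 1) M' t = bisimType V (n + 1) M' (π x).state := by
    refine ⟨e (⟨l, Nat.lt_succ_of_le hl⟩, ⟨b, hb⟩, ⟨_, t, rfl⟩), ?_⟩
    have hstate := (e.symm (e (⟨l, Nat.lt_succ_of_le hl⟩, ⟨b, hb⟩, ⟨_, t, rfl⟩))).2.2.2.choose_spec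
    refine ⟨?_, ?_, (hstate.trans ?_).symm⟩ <;> simp only [π, e.symm_apply_apply]
  obtain ⟨x, hx, hxtag, hxstate⟩ := hπ le_rfl (Finset.none_mem_insertNone (s := V.2)) s'
  refine ⟨m, π, x, fun y a ha t _ => ?_, hx, hxtag, bisimType_eq_of_le le_rfl n.le_succ hxstate⟩
  have hdepth : (π y).depth a ≤ n := (succDepth_le _ _ _).trans (hlevel y)
  have htag : C.tag a ∈ Finset.insertNone V.2 :=
    Finset.mem_insertNone.mpr fun b hb => (FrameClass.mem_tag_iff.mp hb).2 ▸ ha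
  obtain ⟨z, hz, hztag, hzstate⟩ := hπ hdepth htag t
  exact ⟨z, hz, hztag, Agree.of_bisimType_eq (Nat.lt_succ_of_le (hlevel z)) hzstate⟩

end Point

/-! ### Synthesis -/

section Synthesis

variable {V : Vocabulary Atom Agent} {S S' T : Type w} {M : KripkeModel Atom Agent S}
  {M' : KripkeModel Atom Agent S'} {N : KripkeModel Atom Agent T} {Z : S' → S → Prop}
  {x y : Point Agent S'} {t : T}

/-- The precondition of a point `x`: up to depth and tag, the state `t` looks like a state of `M`
that simulates, via `Z`, a state that looks like the one of `x`. -/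
def Simulable (V : Vocabulary Atom Agent) (M : KripkeModel Atom Agent S)
    (M' : KripkeModel Atom Agent S') (Z : S' → S → Prop) (x : Point Agent S')
    (N : KripkeModel Atom Agent T) (t : T) : Prop :=
  ∃ q r, Z q r ∧ Agree V x.level x.tag M' x.state M' q ∧ Agree V x.level x.tag M r N t

theorem invariant_simulable (x : Point Agent S') :
    PointedProperty.Invariant.{u, v, w} C V (x.level + 1)
      fun _ N t => Simulable V M M' Z x N t :=
  fun _ _ _ _ _ _ _ _ e ⟨q, r, hqr, hq, hr⟩ =>
    ⟨q, r, hqr, hq, hr.trans (.of_bisimType_eq (Nat.lt_succ_self _) e)⟩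

theorem Simulable.mem_val_iff (hZ : ∀ q r, Z q r → ∀ p, q ∈ M'.val p ↔ r ∈ M.val p)
    (hx : 0 < x.level) (h : Simulable V M M' Z x N t) {p : Atom} (hp : p ∈ V.1) :
    t ∈ N.val p ↔ x.state ∈ M'.val p := by
  obtain ⟨q, r, hqr, hq, hr⟩ := h
  rw [← hr.mem_val_iff hx hp, ← hZ q r hqr p, hq.mem_val_iff hx hp]

theorem Simulable.exists_rel (hM : C.Frame M.rel) (hM' : C.Frame M'.rel) (hN : C.Frame N.rel)
    (hZ : ∀ q r, Z q r → ∀ a q', M'.rel a q q' → ∃ r', M.rel a r r' ∧ Z q' r')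
    (hx : 0 < x.level) (h : Simulable V M M' Z x N t) {a : Agent} (ha : a ∈ V.2) {t' : S'}
    (ht' : M'.rel a x.state t') (hy : x.Tracks C V M' a t' y) :
    ∃ u, N.rel a t u ∧ Simulable V M M' Z y N u := by
  obtain ⟨q, r, hqr, hq, hr⟩ := h
  obtain ⟨q', hqq', hq'⟩ := hq.exists_rel hM' hM' hx ha ht'
  obtain ⟨r', hrr', hqr'⟩ := hZ q r hqr a q' hqq'
  obtain ⟨u, htu, hu⟩ := hr.exists_rel hM hN hx ha hrr'
  rw [← Point.depth, ← hy.level_eq, ← hy.tag_eq] at hq' hu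
  exact ⟨u, htu, q', r', hqr', hy.agree.symm.trans hq', hu⟩

theorem bisimType_update_points (hM : C.Frame M.rel) (hM' : C.Frame M'.rel)
    (hN : C.Frame N.rel) (hval : ∀ q r, Z q r → ∀ p, q ∈ M'.val p ↔ r ∈ M.val p)
    (hforth : ∀ q r, Z q r → ∀ a q', M'.rel a q q' → ∃ r', M.rel a r r' ∧ Z q' r')
    {P : Type} {π : P → Point Agent S'} (hπ : Point.Closed C V M' π) {h : T → P → Prop}
    (hh : ∀ t x, h t x ↔ Simulable V M M' Z (π x) N t) {k : ℕ} {x : P} (hk : k ≤ (π x).level)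
    (htx : h t x) :
    bisimType V k (N.update (fun a x y => Point.rel C V M' a (π x) (π y)) h) ⟨(t, x), htx⟩ =
      bisimType V k M' (π x).state := by
  induction k generalizing t x with
  | zero => rfl
  | succ k ih =>
    have hx : 0 < (π x).level := by omega
    have hdepth (a : Agent) : k ≤ (π x).depth a := le_succDepth_of_lt hk _ a
    refine bisimType_succ_eq_iff.mpr
      ⟨fun p hp => ((hh t x).mp htx).mem_val_iff hval hx hp, fun a ha => ?_⟩
    refine Set.Subset.antisymm ?_ ?_
    · rintro _ ⟨⟨⟨u, y⟩, huy⟩, ⟨-, hlevel, ⟨t', ht', e⟩, -⟩, rfl⟩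
      refine ⟨t', ht', ?_⟩
      rw [ih ((hdepth a).trans hlevel) huy]
      exact bisimType_eq_of_le le_rfl (hdepth a) e
    · rintro _ ⟨t', ht', rfl⟩
      obtain ⟨y, hy⟩ := hπ x a ha t' ht'
      obtain ⟨u, htu, hu⟩ := ((hh t x).mp htx).exists_rel hM hM' hN hforth hx ha ht' hy
      have hky : k ≤ (π y).level := hy.level_eq ▸ hdepth a
      refine ⟨⟨(u, y), (hh u y).mpr hu⟩, ⟨htu, hy.rel hM' ha ht'⟩, ?_⟩
      rw [ih hky]
      exact bisimType_eq_of_le le_rfl hky hy.agree.1.symm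

theorem exists_actionModel_bisimType_eq [Nonempty Atom] (V : Vocabulary Atom Agent) (n : ℕ)
    (hM : M.InClass C) (hM' : M'.InClass C) {s : S} {s' : S'} (href : Refines M' s' M s) :
    ∃ (A : ActionModel Agent (Form Atom Agent)) (x : A.Point), A.InClass C ∧
      (∀ y, (A.pre y).InLang C) ∧
      ∀ ⦃T : Type w⦄ ⦃N : KripkeModel Atom Agent T⦄ ⦃t : T⦄, N.InClass C →
        bisimType V n M s = bisimType V n N t → ∃ h : Sat C (A.pre x) N t,
          bisimType V n (N.prod C A) ⟨(t, x), h⟩ = bisimType V n M' s' := by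
  obtain ⟨Z, hval, hforth, hs⟩ := href
  obtain ⟨m, π, x, hπ, hlevel, htag, hstate⟩ := Point.exists_closed_family C V n M' s'
  have hdef (y : Fin m) : Definable C fun (_ : Type w) N t => Simulable V M M' Z (π y) N t :=
    .of_invariant (invariant_simulable (π y))
  choose pre hpre hsat using hdef
  refine ⟨⟨Fin m, inferInstance, ⟨x⟩, fun a y z => Point.rel C V M' a (π y) (π z), pre⟩, x,
    Point.frame_rel hM'.2 π, hpre, fun T N t hN e => ?_⟩
  have hx : Sat C (pre x) N t := by
    refine (hsat x T N t hN).mpr ⟨s', s, hs, ?_, ?_⟩ <;> rw [hlevel, htag, Agree.none_iff]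
    exacts [hstate.symm, e]
  exact ⟨hx, (bisimType_update_points hM.2 hM'.2 hN.2 hval hforth hπ
    (fun t y => hsat y T N t hN) hlevel.ge hx).trans hstate.symm⟩

end Synthesis

/-! ### Invariance of formulas -/

/-- On models in `C`, the truth of the formula depends only on the bisimulation type of
depth `n`. -/
abbrev Form.Invariant (C : FrameClass) (V : Vocabulary Atom Agent) (n : ℕ)
    (φ : Form Atom Agent) : Prop :=
  PointedProperty.Invariant.{u, v, w} C V n fun _ M s => Sat C φ M s

section Invariance

variable {V : Vocabulary Atom Agent} {n : ℕ} {φ : Form Atom Agent}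

theorem Form.Invariant.neg (h : Form.Invariant.{u, v, w} C V n φ) :
    Form.Invariant.{u, v, w} C V n φ.neg :=
  fun _ _ _ _ _ _ hM hM' e hs hs' => hs (h hM' hM e.symm hs')

theorem Form.Invariant.box {a : Agent} (ha : a ∈ V.2) (h : Form.Invariant.{u, v, w} C V n φ) :
    Form.Invariant.{u, v, w} C V (n + 1) (φ.box a) := by
  intro S S' M M' s s' hM hM' e hs t' ht'
  obtain ⟨t, ht, et⟩ := ((bisimType_succ_eq_iff.mp e).2 a ha).superset ⟨t', ht', rfl⟩
  exact h hM hM' et (hs t ht)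

theorem Form.Invariant.boxAct {A : ActionModel Agent (Form Atom Agent)} {T : Set A.Point} {m : ℕ}
    (hA : A.InClass C) (hpre : ∀ t, Form.Invariant.{u, v, w} C V m (A.pre t))
    (h : Form.Invariant.{u, v, w} C V n φ) :
    Form.Invariant.{u, v, w} C V (m + n) (.boxAct A T φ) := by
  intro S S' M M' s s' hM hM' e hs hprod' t ht hst'
  have hpre_iff (r r') (er : bisimType V m M r = bisimType V m M' r') (t) :
      Sat C (A.pre t) M r ↔ Sat C (A.pre t) M' r' :=
    ⟨hpre t hM hM' er, hpre t hM' hM er.symm⟩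
  have hst := (hpre_iff s s' (bisimType_eq_of_le le_rfl (Nat.le_add_right m n) e) t).mpr hst'
  have hprod : (M.prod C A).InClass C := hM.update hA hst
  exact h hprod hprod' (bisimType_update_congr hpre_iff n hst hst' e) (hs hprod t ht hst)

theorem Form.Invariant.allRef [Nonempty Atom] (h : Form.Invariant.{u, v, w} C V n φ) :
    Form.Invariant.{u, v, w} C V n φ.allRef := by
  intro S S' M M' s s' hM hM' e hs T N t hN href
  obtain ⟨A, x, hA, -, hAx⟩ := exists_actionModel_bisimType_eq V n hM' hN href
  obtain ⟨hsx, eN⟩ := hAx hM e.symm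
  have hprod : (M.prod C A).InClass C := hM.update hA hsx
  exact h hprod hN eN (hs _ _ _ hprod (refines_update hsx))

theorem Form.InLang.exists_invariant [Nonempty Atom] (hφ : φ.InLang C) :
    ∃ (V : Vocabulary Atom Agent) (n : ℕ), Form.Invariant.{u, v, w} C V n φ := by
  classical
  induction φ with
  | atom p =>
    exact ⟨({p}, ∅), 1, fun _ _ _ _ _ _ _ _ e =>
      ((bisimType_succ_eq_iff.mp e).1 p (Finset.mem_singleton_self p)).mp⟩
  | neg φ ih =>
    obtain ⟨V, n, h⟩ := ih hφ
    exact ⟨V, n, h.neg⟩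
  | and φ ψ ihφ ihψ =>
    obtain ⟨V, n, hV⟩ := ihφ hφ.1
    obtain ⟨W, m, hW⟩ := ihψ hφ.2
    have hV := hV.mono (V' := V ⊔ W) le_sup_left (le_max_left n m)
    have hW := hW.mono (V' := V ⊔ W) le_sup_right (le_max_right n m)
    exact ⟨V ⊔ W, max n m, fun _ _ _ _ _ _ hM hM' e hs => ⟨hV hM hM' e hs.1, hW hM hM' e hs.2⟩⟩
  | box a φ ih =>
    obtain ⟨V, n, h⟩ := ih hφ
    have ha : a ∈ (V ⊔ (∅, {a})).2 := Finset.mem_union_right _ (Finset.mem_singleton_self a)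
    exact ⟨V ⊔ (∅, {a}), n + 1, Form.Invariant.box ha (h.mono le_sup_left le_rfl)⟩
  | act P finite nonempty rel pre T φ ihpre ih =>
    obtain ⟨V, n, h⟩ := ih hφ.2.2
    choose W m hW using fun t => ihpre t (hφ.2.1 t)
    obtain ⟨⟨W', m'⟩, hle⟩ := Finite.exists_le fun t => (W t, m t)
    exact ⟨V ⊔ W', m' + n, Form.Invariant.boxAct (A := ⟨P, finite, nonempty, rel, pre⟩) hφ.1
      (fun t => (hW t).mono ((hle t).1.trans le_sup_right) (hle t).2) (h.mono le_sup_left le_rfl)⟩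
  | allRef φ ih =>
    obtain ⟨V, n, h⟩ := ih hφ
    exact ⟨V, n, h.allRef⟩

end Invariance

end AAML

theorem mainTheorem12_general {Atom : Type u} {Agent : Type v} [Nonempty Atom]
    (C : AAML.FrameClass) {S : Type w} (M : AAML.KripkeModel Atom Agent S) (hM : M.InClass C)
    (s : S) (φ : AAML.Form Atom Agent) (hφ : φ.InLang C) :
    AAML.Sat C φ.someRef M s ↔
      ∃ (A : AAML.ActionModel Agent (AAML.Form Atom Agent)) (a : A.Point),
        A.InClass C ∧ (∀ t, (A.pre t).InLang C) ∧
          AAML.Sat C (AAML.Form.diaAct A {a} φ) M s := by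
  simp only [AAML.sat_someRef, AAML.sat_diaAct_singleton]
  constructor
  · rintro ⟨S', M', s', hM', href, hs'⟩
    obtain ⟨V, n, hinv⟩ := hφ.exists_invariant
    obtain ⟨A, a, hA, hpre, hAa⟩ := AAML.exists_actionModel_bisimType_eq V n hM hM' href
    obtain ⟨hsa, e⟩ := hAa hM rfl
    have hprod : (M.prod C A).InClass C := hM.update hA hsa
    exact ⟨A, a, hA, hpre, hprod, hsa, hinv hM' hprod e.symm hs'⟩
  · rintro ⟨A, a, -, -, hprod, hsa, hs⟩
    exact ⟨_, _, _, hprod, AAML.refines_update hsa, hs⟩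


theorem mainTheorem12 {Atom : Type u} {Agent : Type v} [Nonempty Atom] [Countable Atom]
    [Nonempty Agent] [Finite Agent] (C : AAML.FrameClass) {S : Type w}
    (M : AAML.KripkeModel Atom Agent S) (hM : M.InClass C) (s : S)
    (φ : AAML.Form Atom Agent) (hφ : φ.InLang C) :
    AAML.Sat C φ.someRef M s ↔
      ∃ (A : AAML.ActionModel Agent (AAML.Form Atom Agent)) (a : A.Point),
        A.InClass C ∧ (∀ t, (A.pre t).InLang C) ∧
          AAML.Sat C (AAML.Form.diaAct A {a} φ) M s :=
  mainTheorem12_general C M hM s φ hφ
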